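/- Let $X$ be a complex Banach space, let $S,T\in B(X)$ be bounded linear operators on $X$, and let $\triangle_{T,S}\in B(B(X))$ be the elementary operator $\triangle_{T,S}(A)=TAS-A$. Suppose that $\triangle^m_{T,S}(I)=0$ for some integer $m\geq 1$, and that $S$ and $T$ are power bounded, i.e. $\sup_{n\ge 0}\|S^n\|<\infty$ and $\sup_{n\ge 0}\|T^n\|<\infty$. Then $S$ is polaroid: every isolated point $\lambda$ of the spectrum $\sigma(S)$ is a pole of the resolvent of $S$, i.e. the ascent of $S-\lambda I$ (the least $n\ge 0$ with $\ker (S-\lambda I)^n=\ker (S-\lambda I)^{n+1}$) and the descent of $S-\lambda I$ (the least $n\ge 0$ with $(S-\lambda I)^nX=(S-\lambda I)^{n+1}X$) are finite and equal. Moreover: (a) if $S$ is invertible, then $S$ is similar to an invertible isometry: there are a Banach space $Y$, a linear homeomorphism $E:X\to Y$ and a surjective linear isometry $V:Y\to Y$ with $S=E^{-1}VE$ (so that $S$ is an invertible isometry for the equivalent norm $x\mapsto\|Ex\|$ on $X$); (b) if $S$ is not invertible, then $\sigma(S)=\{z\in\mathbb C:|z|\le 1\}$. -/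

import Mathlib

universe u

open Filter Topology

/-- The elementary operator `△_{T,S} = L_T R_S - I` on the Banach algebra `B(X)`. -/
noncomputable def elemTriangle {X : Type u} [NormedAddCommGroup X] [NormedSpace ℂ X]
    (T S : X →L[ℂ] X) : (X →L[ℂ] X) →L[ℂ] (X →L[ℂ] X) :=
  (ContinuousLinearMap.mul ℂ (X →L[ℂ] X) T).comp
    ((ContinuousLinearMap.mul ℂ (X →L[ℂ] X)).flip S) - ContinuousLinearMap.id ℂ (X →L[ℂ] X)

theorem elemTriangle_apply {X : Type u} [NormedAddCommGroup X] [NormedSpace ℂ X]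
    (T S A : X →L[ℂ] X) : elemTriangle T S A = T * A * S - A := by
  simp [elemTriangle, mul_assoc]

/-- `A` is power bounded: its powers are uniformly bounded in operator norm. -/
def IsPowerBounded {X : Type u} [NormedAddCommGroup X] [NormedSpace ℂ X]
    (A : X →L[ℂ] X) : Prop :=
  ∃ M : ℝ, ∀ n : ℕ, ‖A ^ n‖ ≤ M

/-- The ascent of `A`: the least `n` with `ker A ^ n = ker A ^ (n + 1)`, and `⊤` if there is none. -/
noncomputable def ascent {X : Type u} [NormedAddCommGroup X] [NormedSpace ℂ X]
    (A : X →L[ℂ] X) : ℕ∞ :=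
  ⨅ (n : ℕ) (_ : LinearMap.ker ((A ^ n : X →L[ℂ] X) : X →ₗ[ℂ] X) =
    LinearMap.ker ((A ^ (n + 1) : X →L[ℂ] X) : X →ₗ[ℂ] X)), (n : ℕ∞)

/-- The descent of `A`: the least `n` with `ran A ^ n = ran A ^ (n + 1)`, and `⊤` if there is
none. -/
noncomputable def descent {X : Type u} [NormedAddCommGroup X] [NormedSpace ℂ X]
    (A : X →L[ℂ] X) : ℕ∞ :=
  ⨅ (n : ℕ) (_ : LinearMap.range ((A ^ n : X →L[ℂ] X) : X →ₗ[ℂ] X) =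
    LinearMap.range ((A ^ (n + 1) : X →L[ℂ] X) : X →ₗ[ℂ] X)), (n : ℕ∞)

/-- The isolated points of the spectrum of `A`. -/
def isoSpectrum {X : Type u} [NormedAddCommGroup X] [NormedSpace ℂ X]
    (A : X →L[ℂ] X) : Set ℂ :=
  {z | z ∈ spectrum ℂ A ∧ ¬ AccPt z (𝓟 (spectrum ℂ A))}

/-- The poles (of the resolvent) of `A`: the isolated points `z` of the spectrum such that the
ascent and the descent of `A - z` are finite and equal. -/
def poles {X : Type u} [NormedAddCommGroup X] [NormedSpace ℂ X]
    (A : X →L[ℂ] X) : Set ℂ :=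
  {z | z ∈ isoSpectrum A ∧
    ascent (A - z • (1 : X →L[ℂ] X)) = descent (A - z • (1 : X →L[ℂ] X)) ∧
    ascent (A - z • (1 : X →L[ℂ] X)) < ⊤}

/-- `A` is polaroid: the isolated points of its spectrum are exactly its poles. -/
def IsPolaroid {X : Type u} [NormedAddCommGroup X] [NormedSpace ℂ X]
    (A : X →L[ℂ] X) : Prop :=
  isoSpectrum A = poles A

/-- `A` is similar to an invertible isometry: there are a Banach space `Y`, a linear homeomorphism
`E : X → Y` and a surjective linear isometry `V` of `Y` with `E A = V E`. Equivalently, `A` is an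
invertible isometry for the equivalent norm `x ↦ ‖E x‖` on `X`. -/
def IsSimilarToInvertibleIsometry {X : Type u} [NormedAddCommGroup X] [NormedSpace ℂ X]
    (A : X →L[ℂ] X) : Prop :=
  ∃ (Y : Type u) (_ : NormedAddCommGroup Y) (_ : NormedSpace ℂ Y) (_ : CompleteSpace Y)
    (E : X ≃L[ℂ] Y) (V : Y ≃ₗᵢ[ℂ] Y), ∀ x : X, E (A x) = V (E x)

/-! If `A = △ B` and `△ A = 0`, then `T ^ n * B * S ^ n = B + n A`; power boundedness keeps the left
side bounded, so `A = 0`. Hence the order `m` descends to one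
(`mul_eq_one_of_elemTriangle_pow_eq_zero`): `T` is a power bounded left inverse of `S`.

If `S` is not invertible, no point of the open disc lies in the resolvent set
(`isUnit_of_mem_resolventSet`), so the spectrum is the closed disc, which has no isolated points.

If `S` is invertible, then `T` is its inverse, all integer powers of `S` are bounded, and the
supremum of the norm over orbits is an equivalent norm making `S` isometric. The spectrum lies on
the unit circle and the resolvent is bounded by a multiple of the inverse distance to the circle, so
an isolated spectral point is a simple pole (`exists_differentiableAt_eq_sub_smul`), with ascent and
descent one. -/

/-! ### Isolated singularities on the unit circle -/

/-- The quadratic `(z - c) ^ 2 + c * z * ε ^ 2` vanishes at the two points where the circle of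
radius `ε` about a unimodular `c` meets the unit circle. -/
theorem norm_sq_add_mul_of_norm_sub_eq {c z : ℂ} {ε : ℝ} (hc : ‖c‖ = 1)
    (hz : ‖z - c‖ = ε) :
    ‖(z - c) ^ 2 + c * z * (ε : ℂ) ^ 2‖ = ε * |‖z‖ ^ 2 - 1| := by
  have h1 : (z - c) * (starRingEnd ℂ (z - c)) = (ε : ℂ) ^ 2 := by
    rw [Complex.mul_conj', hz]
  have h2 : c * starRingEnd ℂ c = 1 := by
    rw [Complex.mul_conj', hc]; simp
  have h3 : z * starRingEnd ℂ z = (‖z‖ : ℂ) ^ 2 := Complex.mul_conj' z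
  have h4 : (z - c) ^ 2 + c * z * (ε : ℂ) ^ 2 = c * (z - c) * ((‖z‖ ^ 2 - 1 : ℝ) : ℂ) := by
    push_cast
    rw [← h1, ← h3]
    rw [map_sub]
    linear_combination (-(z - c) * (z - c) - (z - c) * c) * h2
  rw [h4, norm_mul, norm_mul, hc, hz, one_mul, Complex.norm_real, Real.norm_eq_abs]

theorem frontier_annulus_subset {c : ℂ} {ε r : ℝ} :
    frontier {z : ℂ | ε < ‖z - c‖ ∧ ‖z - c‖ < r} ⊆ {z | ‖z - c‖ = ε ∨ ‖z - c‖ = r} := by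
  have hcont : Continuous fun z : ℂ => ‖z - c‖ := by fun_prop
  intro z hz
  have h := frontier_inter_subset {z : ℂ | ε < ‖z - c‖} {z : ℂ | ‖z - c‖ < r} hz
  rcases h with h | h
  · exact Or.inl (frontier_lt_subset_eq continuous_const hcont h.1).symm
  · exact Or.inr (frontier_lt_subset_eq hcont continuous_const h.2)

theorem closure_annulus_subset {c : ℂ} {ε r : ℝ} :
    closure {z : ℂ | ε < ‖z - c‖ ∧ ‖z - c‖ < r} ⊆ {z | ε ≤ ‖z - c‖ ∧ ‖z - c‖ ≤ r} := by
  have hcont : Continuous fun z : ℂ => ‖z - c‖ := by fun_prop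
  refine closure_minimal (fun z hz => ⟨hz.1.le, hz.2.le⟩) ?_
  exact (isClosed_le continuous_const hcont).inter (isClosed_le hcont continuous_const)

section IsolatedSingularity

variable {E : Type*} [NormedAddCommGroup E] [NormedSpace ℂ E]

/-- Maximum principle on shrinking annuli: an isolated singularity at a point of the unit circle
at which `f` grows no faster than the inverse distance to the circle has order at most two. -/
theorem exists_norm_sq_smul_le {f : ℂ → E} {c : ℂ} {r M : ℝ} (hc : ‖c‖ = 1)
    (hr : 0 < r) (hd : ∀ z, z ≠ c → ‖z - c‖ ≤ r → DifferentiableAt ℂ f z)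
    (hM : ∀ z, z ≠ c → ‖z - c‖ ≤ r → |‖z‖ - 1| * ‖f z‖ ≤ M) :
    ∃ C, ∀ z, z ≠ c → ‖z - c‖ ≤ r → ‖(z - c) ^ 2 • f z‖ ≤ C := by
  have hM0 : 0 ≤ M := by
    refine le_trans (by positivity) (hM (c + r) ?_ ?_)
    · simpa using hr.ne'
    · simp [abs_of_pos hr]
  have hsph : ContinuousOn f (Metric.sphere c r) := fun z hz =>
    (hd z (by rintro rfl; simp [hr.ne] at hz) (by simpa [dist_eq_norm] using hz.le)
      ).continuousAt.continuousWithinAt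
  obtain ⟨K, hK⟩ := (isCompact_sphere c r).exists_bound_of_continuousOn hsph
  have hK0 : 0 ≤ K := by
    refine (norm_nonneg _).trans (hK (c + r) ?_)
    simp [abs_of_pos hr]
  -- The summands bound `g` below on the outer and on the inner circle; neither involves `ε`.
  set C := (r ^ 2 + (1 + r) * r ^ 2) * K + r * ((2 + r) * M) with hC
  have hz1 : ∀ z, ‖z - c‖ ≤ r → ‖z‖ ≤ 1 + r := fun z hz => by
    calc ‖z‖ = ‖c + (z - c)‖ := by congr 1; ring
      _ ≤ ‖c‖ + ‖z - c‖ := norm_add_le _ _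
      _ ≤ 1 + r := by rw [hc]; gcongr
  -- On the inner circle the multiplier has a factor `|‖z‖ ^ 2 - 1|` absorbing the growth of `f`; as
  -- `ε → 0` it tends to `(z - c) ^ 2`.
  have key : ∀ ε, 0 < ε → ε < r → ∀ z, ε ≤ ‖z - c‖ → ‖z - c‖ ≤ r →
      ‖((z - c) ^ 2 + c * z * (ε : ℂ) ^ 2) • f z‖ ≤ C := by
    intro ε hε hεr z hzε hzr
    set g : ℂ → E := fun z => ((z - c) ^ 2 + c * z * (ε : ℂ) ^ 2) • f z
    have hne : ∀ w, ε ≤ ‖w - c‖ → w ≠ c := by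
      rintro w hw rfl
      simp at hw; linarith
    have hinner : ∀ w, ‖w - c‖ = ε → ‖g w‖ ≤ C := by
      intro w hw
      have hwr : ‖w - c‖ ≤ r := hw ▸ hεr.le
      rw [norm_smul, norm_sq_add_mul_of_norm_sub_eq hc hw]
      have h5 : |‖w‖ ^ 2 - 1| = (‖w‖ + 1) * |‖w‖ - 1| := by
        rw [show ‖w‖ ^ 2 - 1 = (‖w‖ + 1) * (‖w‖ - 1) by ring, abs_mul,
          abs_of_nonneg (show 0 ≤ ‖w‖ + 1 by positivity)]
      have h6 := hM w (hne w hw.ge) hwr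
      have h7 : ‖w‖ + 1 ≤ 2 + r := by linarith [hz1 w hwr]
      calc ε * |‖w‖ ^ 2 - 1| * ‖f w‖ = ε * ((‖w‖ + 1) * (|‖w‖ - 1| * ‖f w‖)) := by
            rw [h5]; ring
        _ ≤ ε * ((2 + r) * (|‖w‖ - 1| * ‖f w‖)) := by gcongr
        _ ≤ r * ((2 + r) * M) := by gcongr
        _ ≤ C := by rw [hC]; have : 0 ≤ (r ^ 2 + (1 + r) * r ^ 2) * K := by positivity
                    linarith
    have houter : ∀ w, ‖w - c‖ = r → ‖g w‖ ≤ C := by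
      intro w hw
      have h8 : ‖(w - c) ^ 2 + c * w * (ε : ℂ) ^ 2‖ ≤ r ^ 2 + (1 + r) * r ^ 2 := by
        refine (norm_add_le _ _).trans ?_
        rw [norm_pow, hw, norm_mul, norm_mul, hc, one_mul, norm_pow, Complex.norm_real,
          Real.norm_eq_abs, abs_of_pos hε]
        have := hz1 w hw.le
        gcongr
      rw [norm_smul]
      calc _ ≤ (r ^ 2 + (1 + r) * r ^ 2) * K := by
            gcongr
            exact hK w (by simpa [dist_eq_norm] using hw)
        _ ≤ C := by rw [hC]; have : 0 ≤ r * ((2 + r) * M) := by positivity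
                    linarith
    have hgd : ∀ w, ε ≤ ‖w - c‖ → ‖w - c‖ ≤ r → DifferentiableAt ℂ g w := fun w h1 h2 =>
      DifferentiableAt.smul (by fun_prop) (hd w (hne w h1) h2)
    rcases hzε.eq_or_lt with h | h
    · exact hinner z h.symm
    rcases hzr.eq_or_lt with h' | h'
    · exact houter z h'
    refine Complex.norm_le_of_forall_mem_frontier_norm_le
      (U := {z : ℂ | ε < ‖z - c‖ ∧ ‖z - c‖ < r}) ?_ ?_ ?_ (subset_closure ⟨h, h'⟩) (f := g)
    · refine (Metric.isBounded_ball (x := c) (r := r)).subset fun w hw => ?_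
      simpa [dist_eq_norm] using hw.2
    · refine DifferentiableOn.diffContOnCl fun w hw => ?_
      have := closure_annulus_subset hw
      exact (hgd w this.1 this.2).differentiableWithinAt
    · intro w hw
      rcases frontier_annulus_subset hw with h | h
      exacts [hinner w h, houter w h]
  refine ⟨C, fun z hz hzr => ?_⟩
  have hpos : 0 < ‖z - c‖ := norm_pos_iff.2 (sub_ne_zero.2 hz)
  have hlim : Tendsto (fun ε : ℝ => ‖((z - c) ^ 2 + c * z * (ε : ℂ) ^ 2) • f z‖) (𝓝[>] 0)
      (𝓝 ‖(z - c) ^ 2 • f z‖) := by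
    have : Continuous fun ε : ℝ => ‖((z - c) ^ 2 + c * z * (ε : ℂ) ^ 2) • f z‖ := by fun_prop
    simpa using (this.tendsto 0).mono_left nhdsWithin_le_nhds
  refine le_of_tendsto hlim ?_
  filter_upwards [Ioo_mem_nhdsGT hpos] with ε hε
  exact key ε hε.1 (hε.2.trans_le hzr) z hε.2.le hzr

/-- An isolated singularity at a point of the unit circle at which `f` grows no faster than the
inverse distance to the circle is at most a simple pole. -/
theorem exists_differentiableAt_eq_sub_smul [CompleteSpace E] {f : ℂ → E} {c : ℂ} {r M : ℝ}
    (hc : ‖c‖ = 1) (hr : 0 < r) (hd : ∀ z, z ≠ c → ‖z - c‖ ≤ r → DifferentiableAt ℂ f z)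
    (hM : ∀ z, z ≠ c → ‖z - c‖ ≤ r → |‖z‖ - 1| * ‖f z‖ ≤ M) :
    ∃ G : ℂ → E, DifferentiableAt ℂ G c ∧ ∀ᶠ z in 𝓝[≠] c, G z = (z - c) • f z := by
  obtain ⟨C, hC⟩ := exists_norm_sq_smul_le hc hr hd hM
  set g : ℂ → E := fun z => (z - c) ^ 2 • f z with hg
  set H := Function.update g c (limUnder (𝓝[≠] c) g) with hH
  have hball : Metric.closedBall c r ∈ 𝓝 c := Metric.closedBall_mem_nhds c hr
  have hmem : ∀ z ∈ Metric.closedBall c r \ {c}, z ≠ c ∧ ‖z - c‖ ≤ r := fun z hz =>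
    ⟨hz.2, by simpa [dist_eq_norm] using hz.1⟩
  have hHd : DifferentiableOn ℂ H (Metric.closedBall c r) := by
    refine Complex.differentiableOn_update_limUnder_of_bddAbove hball (fun z hz => ?_)
      ⟨C, ?_⟩
    · obtain ⟨h1, h2⟩ := hmem z hz
      exact (DifferentiableAt.smul (by fun_prop) (hd z h1 h2)).differentiableWithinAt
    · rintro _ ⟨z, hz, rfl⟩
      obtain ⟨h1, h2⟩ := hmem z hz
      exact hC z h1 h2
  have hHne : ∀ z, z ≠ c → H z = g z := fun z hz => Function.update_of_ne hz _ _
  have hcont : ContinuousAt H c := (hHd.differentiableAt hball).continuousAt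
  have hc0 : c ≠ 0 := by rintro rfl; simp at hc
  -- Along the radius `c * (1 + t)` the growth bound gives `‖g‖ = t ^ 2 * ‖f‖ ≤ t * M`. This zero of
  -- `H` lowers the order of the pole from two to one.
  have hHc : H c = 0 := by
    have hpath : Tendsto (fun t : ℝ => c * (1 + t)) (𝓝[>] 0) (𝓝 c) := by
      have : Continuous fun t : ℝ => c * (1 + t) := by fun_prop
      simpa using (this.tendsto 0).mono_left nhdsWithin_le_nhds
    refine tendsto_nhds_unique (hcont.tendsto.comp hpath) ?_
    have hbd : Tendsto (fun t : ℝ => t * M) (𝓝[>] 0) (𝓝 0) := by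
      have : Continuous fun t : ℝ => t * M := by fun_prop
      simpa using (this.tendsto 0).mono_left nhdsWithin_le_nhds
    refine squeeze_zero_norm' ?_ hbd
    filter_upwards [Ioo_mem_nhdsGT hr] with t ht
    have ht0 : 0 < t := ht.1
    have hsub : c * (1 + t) - c = c * t := by ring
    have hn : ‖c * (1 + (t : ℂ)) - c‖ = t := by
      rw [hsub, norm_mul, hc, one_mul, Complex.norm_real, Real.norm_eq_abs, abs_of_pos ht0]
    have hne : c * (1 + (t : ℂ)) ≠ c := by
      intro h; rw [h, sub_self, norm_zero] at hn; exact ht0.ne hn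
    have hz : ‖c * (1 + (t : ℂ))‖ = 1 + t := by
      rw [norm_mul, hc, one_mul]
      rw [show (1 + (t : ℂ)) = ((1 + t : ℝ) : ℂ) by push_cast; rfl, Complex.norm_real,
        Real.norm_eq_abs, abs_of_pos (by linarith)]
    have h := hM _ hne (hn.le.trans ht.2.le)
    rw [hz, add_sub_cancel_left, abs_of_pos ht0] at h
    simp only [Function.comp_apply]
    rw [hHne _ hne, hg]
    simp only [norm_smul, norm_pow, hn]
    calc t ^ 2 * _ = t * (t * ‖f (c * (1 + t))‖) := by ring
      _ ≤ t * M := by gcongr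
  refine ⟨dslope H c, ((Complex.differentiableOn_dslope hball).2 hHd).differentiableAt hball, ?_⟩
  filter_upwards [self_mem_nhdsWithin] with z hz
  have hz' : z ≠ c := hz
  rw [dslope_of_ne _ hz', slope_def_module, hHc, sub_zero, hHne z hz', hg, smul_smul, pow_two,
    inv_mul_cancel_left₀ (sub_ne_zero.2 hz')]

end IsolatedSingularity

/-! ### Resolvents of power bounded elements -/

theorem ringInverse_eq_of_mul_eq_one {A : Type*} [MonoidWithZero A] {a b : A}
    (h₁ : a * b = 1) (h₂ : b * a = 1) :
    Ring.inverse a = b :=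
  Ring.inverse_unit ⟨a, b, h₁, h₂⟩

section PowerBoundedAlgebra

variable {A : Type*} [NormedRing A] [NormedAlgebra ℂ A] [CompleteSpace A]

/-- The Neumann series is dominated by `M` times a geometric series. -/
theorem exists_inverse_one_sub_smul {a : A} {M : ℝ} (ha : ∀ n : ℕ, ‖a ^ n‖ ≤ M) {z : ℂ}
    (hz : ‖z‖ < 1) :
    ∃ b : A, (1 - z • a) * b = 1 ∧ b * (1 - z • a) = 1 ∧ ‖b‖ ≤ M * (1 - ‖z‖)⁻¹ := by
  have hb : ∀ n : ℕ, ‖(z • a) ^ n‖ ≤ M * ‖z‖ ^ n := fun n => by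
    rw [smul_pow, norm_smul, norm_pow, mul_comm]
    gcongr
    exact ha n
  have hg := (hasSum_geometric_of_lt_one (norm_nonneg z) hz).mul_left M
  have hs : Summable fun n : ℕ => (z • a) ^ n := Summable.of_norm_bounded hg.summable hb
  exact ⟨∑' n : ℕ, (z • a) ^ n, hs.one_sub_mul_tsum_pow, hs.tsum_pow_mul_one_sub,
    tsum_of_norm_bounded hg hb⟩

theorem resolvent_of_one_lt_norm {a : A} {M : ℝ} (ha : ∀ n : ℕ, ‖a ^ n‖ ≤ M) {z : ℂ}
    (hz : 1 < ‖z‖) :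
    z ∈ resolventSet ℂ a ∧ (‖z‖ - 1) * ‖resolvent a z‖ ≤ M := by
  have hpos : 0 < ‖z‖ := one_pos.trans hz
  have hz0 : z ≠ 0 := norm_pos_iff.1 hpos
  obtain ⟨b, h1, h2, h3⟩ := exists_inverse_one_sub_smul ha (z := z⁻¹)
    (by rw [norm_inv]; exact inv_lt_one_of_one_lt₀ hz)
  have heq : algebraMap ℂ A z - a = z • (1 - z⁻¹ • a) := by
    rw [smul_sub, smul_inv_smul₀ hz0, Algebra.algebraMap_eq_smul_one]
  have e1 : (algebraMap ℂ A z - a) * (z⁻¹ • b) = 1 := by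
    rw [heq, smul_mul_smul_comm, h1, mul_inv_cancel₀ hz0, one_smul]
  have e2 : (z⁻¹ • b) * (algebraMap ℂ A z - a) = 1 := by
    rw [heq, smul_mul_smul_comm, h2, inv_mul_cancel₀ hz0, one_smul]
  refine ⟨⟨⟨_, _, e1, e2⟩, rfl⟩, ?_⟩
  rw [resolvent, ringInverse_eq_of_mul_eq_one e1 e2, norm_smul]
  rw [norm_inv] at h3 ⊢
  have h4 : 0 < ‖z‖ - 1 := by linarith
  calc (‖z‖ - 1) * (‖z‖⁻¹ * ‖b‖) ≤ (‖z‖ - 1) * (‖z‖⁻¹ * (M * (1 - ‖z‖⁻¹)⁻¹)) := by gcongr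
    _ = M := by
      have : 1 - ‖z‖⁻¹ = (‖z‖ - 1) * ‖z‖⁻¹ := by field_simp
      rw [this]
      field_simp

/-- Factor `z - a = -a * (1 - z • b)`; the second `M` is the cost of the factor `b` in the inverse.
-/
theorem resolvent_of_norm_lt_one {a b : A} {M : ℝ} (hab : a * b = 1) (hba : b * a = 1)
    (hb : ∀ n : ℕ, ‖b ^ n‖ ≤ M) {z : ℂ} (hz : ‖z‖ < 1) :
    z ∈ resolventSet ℂ a ∧ (1 - ‖z‖) * ‖resolvent a z‖ ≤ M * M := by
  obtain ⟨d, h1, h2, h3⟩ := exists_inverse_one_sub_smul hb hz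
  have f1 : algebraMap ℂ A z - a = -(a * (1 - z • b)) := by
    rw [mul_sub, mul_smul_comm, hab, Algebra.algebraMap_eq_smul_one, mul_one, neg_sub]
  have e1 : (algebraMap ℂ A z - a) * -(d * b) = 1 := by
    rw [f1, neg_mul_neg, mul_assoc, ← mul_assoc _ d, h1, one_mul, hab]
  have e2 : -(d * b) * (algebraMap ℂ A z - a) = 1 := by
    rw [f1, neg_mul_neg, mul_assoc, ← mul_assoc b, hba, one_mul, h2]
  refine ⟨⟨⟨_, _, e1, e2⟩, rfl⟩, ?_⟩
  rw [resolvent, ringInverse_eq_of_mul_eq_one e1 e2, norm_neg]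
  have h4 : 0 < 1 - ‖z‖ := by linarith
  have hb1 : ‖b‖ ≤ M := by simpa using hb 1
  have hM : 0 ≤ M := (norm_nonneg _).trans hb1
  calc (1 - ‖z‖) * ‖d * b‖ ≤ (1 - ‖z‖) * ((M * (1 - ‖z‖)⁻¹) * M) := by
        gcongr
        refine (norm_mul_le _ _).trans ?_
        gcongr
    _ = M * M := by field_simp

/-- If `b` is a power bounded left inverse of `a` and `a - z` is invertible for some `z` in the
open unit disc, then `a` is invertible. -/
theorem isUnit_of_mem_resolventSet {a b : A} {M : ℝ} (hba : b * a = 1)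
    (hb : ∀ n : ℕ, ‖b ^ n‖ ≤ M) {z : ℂ} (hz : ‖z‖ < 1) (hr : z ∈ resolventSet ℂ a) :
    IsUnit a := by
  obtain ⟨d, h1, h2, -⟩ := exists_inverse_one_sub_smul hb hz
  obtain ⟨v, hv⟩ := hr
  -- `b` times the unit `z - a` is a unit, so `b` is a unit and `a` is its inverse.
  have hw : b * ↑v = -(1 - z • b) := by
    rw [hv, mul_sub, hba, Algebra.algebraMap_eq_smul_one, mul_smul_comm, mul_one, neg_sub]
  have hunit : IsUnit (b * (v : A)) := by
    rw [hw]; exact IsUnit.neg ⟨⟨_, _, h1, h2⟩, rfl⟩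
  have hbu : IsUnit b := (Units.isUnit_mul_units b v).1 hunit
  obtain ⟨w, rfl⟩ := hbu
  rw [show a = ((w⁻¹ : Aˣ) : A) from (left_inv_eq_right_inv w.inv_mul hba).symm]
  exact Units.isUnit _

/-- At an isolated point `c` of the spectrum of a doubly power bounded element `a`,
`(c - a) ^ 2` divides `c - a`. -/
theorem exists_sq_mul_eq_of_isolated {a b : A} {M : ℝ} (hab : a * b = 1) (hba : b * a = 1)
    (ha : ∀ n : ℕ, ‖a ^ n‖ ≤ M) (hb : ∀ n : ℕ, ‖b ^ n‖ ≤ M) {c : ℂ}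
    (hc : c ∈ spectrum ℂ a) (hiso : ¬ AccPt c (𝓟 (spectrum ℂ a))) :
    ∃ d : A, (algebraMap ℂ A c - a) ^ 2 * d = algebraMap ℂ A c - a := by
  have hc1 : ‖c‖ = 1 := by
    by_contra h
    rcases lt_or_gt_of_ne h with h | h
    · exact hc (resolvent_of_norm_lt_one hab hba hb h).1
    · exact hc (resolvent_of_one_lt_norm ha h).1
  have hM0 : 0 ≤ M := (norm_nonneg _).trans (ha 0)
  rw [accPt_iff_frequently_nhdsNE, not_frequently, eventually_nhdsWithin_iff,
    Metric.eventually_nhds_iff] at hiso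
  obtain ⟨δ, hδ, hiso⟩ := hiso
  have hres : ∀ z, z ≠ c → ‖z - c‖ ≤ δ / 2 → z ∈ resolventSet ℂ a := fun z hz hzr => by
    have := hiso (y := z) (by rw [dist_eq_norm]; linarith) hz
    rwa [spectrum, Set.mem_compl_iff, not_not] at this
  obtain ⟨G, hG, hGe⟩ := exists_differentiableAt_eq_sub_smul (f := resolvent a) (M := M + M * M)
    hc1 (half_pos hδ)
    (fun z hz hzr => (spectrum.hasDerivAt_resolvent_const_left (hres z hz hzr)).differentiableAt)
    (fun z _ _ => by
      have hMM : 0 ≤ M * M := by positivity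
      rcases lt_trichotomy ‖z‖ 1 with h | h | h
      · rw [abs_of_neg (by linarith), neg_sub]
        linarith [(resolvent_of_norm_lt_one hab hba hb h).2]
      · rw [h, sub_self, abs_zero, zero_mul]; linarith
      · rw [abs_of_pos (by linarith)]
        linarith [(resolvent_of_one_lt_norm ha h).2])
  have hmul : ∀ᶠ z in 𝓝[≠] c, (algebraMap ℂ A z - a) * G z = algebraMap ℂ A (z - c) := by
    have hnear : ∀ᶠ z in 𝓝[≠] c, z ∈ resolventSet ℂ a := by
      rw [eventually_nhdsWithin_iff, Metric.eventually_nhds_iff]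
      refine ⟨δ / 2, half_pos hδ, fun z hz hne => hres z hne ?_⟩
      rw [← dist_eq_norm]; exact hz.le
    filter_upwards [hGe, hnear] with z h1 h2
    rw [h1, mul_smul_comm, resolvent, Ring.mul_inverse_cancel _ h2,
      Algebra.algebraMap_eq_smul_one]
  have hFd : HasDerivAt (fun z : ℂ => (algebraMap ℂ A z - a) * G z)
      (1 * G c + (algebraMap ℂ A c - a) * deriv G c) c := by
    have h1 : HasDerivAt (fun z : ℂ => algebraMap ℂ A z - a) 1 c := by
      simpa using! (Algebra.linearMap ℂ A).hasDerivAt.sub_const a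
    exact h1.mul hG.hasDerivAt
  have hRd : HasDerivAt (fun z : ℂ => algebraMap ℂ A (z - c)) 1 c := by
    have h1 : HasDerivAt (fun z : ℂ => algebraMap ℂ A z - algebraMap ℂ A c) 1 c := by
      simpa using! (Algebra.linearMap ℂ A).hasDerivAt.sub_const (algebraMap ℂ A c)
    simpa only [map_sub] using h1
  have hval : (algebraMap ℂ A c - a) * G c = 0 := by
    have h1 := hFd.continuousAt.tendsto.mono_left (nhdsWithin_le_nhds (s := {c}ᶜ))
    have h2 := hRd.continuousAt.tendsto.mono_left (nhdsWithin_le_nhds (s := {c}ᶜ))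
    have := tendsto_nhds_unique (h1.congr' hmul) h2
    simpa using this
  have hfull : (fun z : ℂ => (algebraMap ℂ A z - a) * G z) =ᶠ[𝓝 c]
      fun z => algebraMap ℂ A (z - c) := by
    rw [eventually_nhdsWithin_iff] at hmul
    filter_upwards [hmul] with z hz
    by_cases h : z = c
    · subst h; simpa using hval
    · exact hz h
  have hderiv : 1 * G c + (algebraMap ℂ A c - a) * deriv G c = 1 :=
    hFd.unique (hRd.congr_of_eventuallyEq hfull)
  -- Differentiating `(z - a) * G z = z - c` at `c` gave `hderiv`; multiplying it by `c - a` kills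
  -- the `G c` term by `hval`.
  refine ⟨deriv G c, ?_⟩
  have h := congrArg ((algebraMap ℂ A c - a) * ·) hderiv
  simp only [one_mul, mul_add, hval, zero_add, mul_one] at h
  rw [pow_two, mul_assoc]
  exact h

end PowerBoundedAlgebra

/-! ### Operators: the left inverse, ascent and descent, renorming by orbits -/

section Operators

variable {X : Type u} [NormedAddCommGroup X] [NormedSpace ℂ X]

theorem pow_mul_mul_pow_of_elemTriangle_eq {T S A B : X →L[ℂ] X}
    (hA : elemTriangle T S A = 0) (hB : elemTriangle T S B = A) (n : ℕ) :
    T ^ n * B * S ^ n = B + (n : ℂ) • A := by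
  rw [elemTriangle_apply, sub_eq_zero] at hA
  rw [elemTriangle_apply, sub_eq_iff_eq_add] at hB
  induction n with
  | zero => simp
  | succ n ih =>
    calc T ^ (n + 1) * B * S ^ (n + 1) = T * (T ^ n * B * S ^ n) * S := by
          rw [pow_succ' T, pow_succ S]; simp only [mul_assoc]
      _ = T * B * S + (n : ℂ) • (T * A * S) := by
          rw [ih, mul_add, add_mul, mul_smul_comm, smul_mul_assoc]
      _ = B + ((n + 1 : ℕ) : ℂ) • A := by
          rw [hA, hB]; push_cast; rw [add_smul, one_smul]; abel

theorem eq_zero_of_norm_add_natCast_smul_le {E : Type*} [NormedAddCommGroup E] [NormedSpace ℂ E]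
    {x y : E} {C : ℝ} (h : ∀ n : ℕ, ‖x + (n : ℂ) • y‖ ≤ C) : y = 0 := by
  by_contra hy
  have hpos : 0 < ‖y‖ := norm_pos_iff.2 hy
  obtain ⟨n, hn⟩ := exists_nat_gt ((C + ‖x‖) / ‖y‖)
  rw [div_lt_iff₀ hpos] at hn
  have h1 : ‖(n : ℂ) • y‖ ≤ ‖x + (n : ℂ) • y‖ + ‖x‖ := by
    simpa using norm_sub_le (x + (n : ℂ) • y) x
  rw [norm_smul, Complex.norm_natCast] at h1
  linarith [h n]

theorem mul_eq_one_of_elemTriangle_pow_eq_zero {T S : X →L[ℂ] X} (hS : IsPowerBounded S)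
    (hT : IsPowerBounded T) {m : ℕ} (h : (elemTriangle T S ^ m) 1 = 0) : T * S = 1 := by
  obtain ⟨M, hM⟩ := hS
  obtain ⟨N, hN⟩ := hT
  have hN0 : 0 ≤ N := (norm_nonneg _).trans (hN 0)
  suffices h1 : elemTriangle T S 1 = 0 by
    rw [elemTriangle_apply, mul_one, sub_eq_zero] at h1
    exact h1
  induction m with
  | zero =>
    -- For `m = 0` the hypothesis forces `X` to be trivial.
    have h0 : (1 : X →L[ℂ] X) = 0 := h
    rw [h0, map_zero]
  | succ k ih =>
    cases k with
    | zero => simpa using h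
    | succ k =>
      refine ih (eq_zero_of_norm_add_natCast_smul_le (x := (elemTriangle T S ^ k) 1)
        (C := N * ‖(elemTriangle T S ^ k) 1‖ * M) fun n => ?_)
      rw [← pow_mul_mul_pow_of_elemTriangle_eq (T := T) (S := S)]
      · refine (norm_mul_le _ _).trans ?_
        gcongr
        · refine (norm_mul_le _ _).trans ?_
          gcongr
          exact hN n
        · exact hM n
      · rw [pow_succ'] at h; exact h
      · rw [pow_succ']; rfl

theorem ascent_eq_one {A : X →L[ℂ] X} {x : X} (hx : A x = 0) (hx0 : x ≠ 0)
    (h : ∀ x, A (A x) = 0 → A x = 0) : ascent A = 1 := by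
  apply le_antisymm
  · refine iInf₂_le_of_le 1 ?_ (by simp)
    ext y
    simpa [pow_succ] using ⟨fun hy => by rw [hy, map_zero], h y⟩
  · refine le_iInf₂ fun n hn => ?_
    rcases Nat.eq_zero_or_pos n with rfl | hpos
    · have : x ∈ LinearMap.ker ((A ^ (0 + 1) : X →L[ℂ] X) : X →ₗ[ℂ] X) := by simpa using hx
      rw [← hn] at this
      exact absurd (by simpa using this) hx0
    · exact_mod_cast hpos

theorem descent_eq_one {A : X →L[ℂ] X} (hs : ¬ Function.Surjective A)
    (h : ∀ x, ∃ y, A (A y) = A x) : descent A = 1 := by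
  apply le_antisymm
  · refine iInf₂_le_of_le 1 ?_ (by simp)
    ext z
    simp only [LinearMap.mem_range, pow_succ, pow_zero, one_mul, ContinuousLinearMap.coe_coe,
      mul_apply_eq_comp]
    constructor
    · rintro ⟨x, rfl⟩; exact h x
    · rintro ⟨y, rfl⟩; exact ⟨_, rfl⟩
  · refine le_iInf₂ fun n hn => ?_
    rcases Nat.eq_zero_or_pos n with rfl | hpos
    · refine absurd (fun z => ?_) hs
      have : z ∈ LinearMap.range ((A ^ 0 : X →L[ℂ] X) : X →ₗ[ℂ] X) := ⟨z, by simp⟩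
      rw [hn] at this
      simpa using this
    · exact_mod_cast hpos

/-- A Jordan chain of length two at a unimodular eigenvalue would make `S ^ n x` grow linearly. -/
theorem apply_eq_of_power_bounded {S : X →L[ℂ] X} {M : ℝ} (hS : ∀ n : ℕ, ‖S ^ n‖ ≤ M) {c : ℂ}
    (hc : ‖c‖ = 1) {x : X} (hx : S (S x - c • x) = c • (S x - c • x)) : S x = c • x := by
  have hc0 : c ≠ 0 := by rintro rfl; simp at hc
  set y := S x - c • x with hy
  have hSx : S x = c • x + y := by rw [hy]; abel
  have hpow : ∀ n : ℕ, (S ^ n) x = c ^ n • (x + (n : ℂ) • c⁻¹ • y) := by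
    intro n
    induction n with
    | zero => simp
    | succ n ih =>
      rw [pow_succ', mul_apply_eq_comp, ih]
      simp only [map_smul, map_add, hSx, hx]
      rw [smul_comm c⁻¹ c y, smul_inv_smul₀ hc0]
      simp only [smul_add, smul_smul]
      push_cast
      rw [show c ^ (n + 1) * ((n + 1 : ℂ) * c⁻¹) = c ^ n * n + c ^ n by
        rw [pow_succ]; field_simp, add_smul, pow_succ]
      abel
  have h0 : c⁻¹ • y = 0 := eq_zero_of_norm_add_natCast_smul_le (x := x) (C := M * ‖x‖) fun n => by
    have := (S ^ n).le_of_opNorm_le (hS n) x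
    rwa [hpow n, norm_smul, norm_pow, hc, one_pow, one_mul] at this
  have hy0 : y = 0 := (smul_eq_zero.1 h0).resolve_left (inv_ne_zero hc0)
  rw [hSx, hy0, add_zero]

/-- The orbit map `x ↦ (n ↦ u ^ n x)` of a doubly power bounded operator `u`, as a bounded
operator into the bounded functions on `ℤ`. -/
noncomputable def orbitMap (u : (X →L[ℂ] X)ˣ) {M : ℝ} (hu : ∀ n : ℤ, ‖((u ^ n : (X →L[ℂ] X)ˣ) :
    X →L[ℂ] X)‖ ≤ M) : X →L[ℂ] BoundedContinuousFunction ℤ X :=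
  LinearMap.mkContinuous
    { toFun := fun x => BoundedContinuousFunction.ofNormedAddCommGroupDiscrete
        (fun n : ℤ => ((u ^ n : (X →L[ℂ] X)ˣ) : X →L[ℂ] X) x) (M * ‖x‖)
        fun n => ContinuousLinearMap.le_of_opNorm_le _ (hu n) x
      map_add' := fun x y => by ext n; simp
      map_smul' := fun a x => by ext n; simp } M fun x =>
    (BoundedContinuousFunction.norm_le
      (mul_nonneg ((norm_nonneg _).trans (hu 0)) (norm_nonneg x))).2
      fun n => ContinuousLinearMap.le_of_opNorm_le _ (hu n) x

theorem orbitMap_apply (u : (X →L[ℂ] X)ˣ) {M : ℝ} (hu : ∀ n : ℤ, ‖((u ^ n : (X →L[ℂ] X)ˣ) :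
    X →L[ℂ] X)‖ ≤ M) (x : X) (n : ℤ) :
    orbitMap u hu x n = ((u ^ n : (X →L[ℂ] X)ˣ) : X →L[ℂ] X) x := rfl

/-- Applying `u ^ k` only shifts the orbit. The cases `k = 1` and `k = -1` together make `u`
isometric for the orbit norm. -/
theorem norm_orbitMap_apply_le (u : (X →L[ℂ] X)ˣ) {M : ℝ} (hu : ∀ n : ℤ,
    ‖((u ^ n : (X →L[ℂ] X)ˣ) : X →L[ℂ] X)‖ ≤ M) (k : ℤ) (x : X) :
    ‖orbitMap u hu (((u ^ k : (X →L[ℂ] X)ˣ) : X →L[ℂ] X) x)‖ ≤ ‖orbitMap u hu x‖ := by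
  refine (BoundedContinuousFunction.norm_le (norm_nonneg _)).2 fun n => ?_
  have h : orbitMap u hu (((u ^ k : (X →L[ℂ] X)ˣ) : X →L[ℂ] X) x) n = orbitMap u hu x (n + k) := by
    rw [orbitMap_apply, orbitMap_apply, zpow_add, Units.val_mul, mul_apply_eq_comp]
  rw [h]
  exact BoundedContinuousFunction.norm_coe_le_norm _ _

variable [CompleteSpace X]

theorem mem_poles_of_doubly_power_bounded {S T : X →L[ℂ] X} {M : ℝ} (hST : S * T = 1)
    (hTS : T * S = 1) (hS : ∀ n : ℕ, ‖S ^ n‖ ≤ M) (hT : ∀ n : ℕ, ‖T ^ n‖ ≤ M) {c : ℂ}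
    (hc : c ∈ isoSpectrum S) : c ∈ poles S := by
  have hc1 : ‖c‖ = 1 := by
    by_contra h
    rcases lt_or_gt_of_ne h with h | h
    · exact hc.1 (resolvent_of_norm_lt_one hST hTS hT h).1
    · exact hc.1 (resolvent_of_one_lt_norm hS h).1
  obtain ⟨d, hd⟩ := exists_sq_mul_eq_of_isolated hST hTS hS hT hc.1 hc.2
  set A : X →L[ℂ] X := S - c • (1 : X →L[ℂ] X) with hA
  have hAS : algebraMap ℂ (X →L[ℂ] X) c - S = -A := by
    rw [hA, Algebra.algebraMap_eq_smul_one, neg_sub]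
  have hAx : ∀ x, A x = S x - c • x := fun x => by simp [hA]
  have hker : ∀ x, A (A x) = 0 → A x = 0 := fun x hx => by
    rw [hAx, sub_eq_zero]
    refine apply_eq_of_power_bounded hS hc1 ?_
    rwa [hAx, hAx, sub_eq_zero] at hx
  have hran : ∀ x, ∃ y, A (A y) = A x := fun x => ⟨-d x, by
    rw [hAS, neg_sq] at hd
    have := congrArg (fun B : X →L[ℂ] X => B x) hd
    simp only [pow_two, mul_apply_eq_comp, neg_apply] at this
    rw [map_neg, map_neg, this, neg_neg]⟩
  -- `hran` makes injectivity imply surjectivity and `hker` the converse, so failure of bijectivity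
  -- means failure of both; this excludes ascent or descent zero.
  have hnu : ¬ Function.Bijective A := fun hb => hc.1 <| by
    change IsUnit (algebraMap ℂ (X →L[ℂ] X) c - S)
    rw [hAS]
    exact (ContinuousLinearMap.isUnit_iff_bijective.2 hb).neg
  have hinj : ¬ Function.Injective A := fun hi => hnu ⟨hi, fun x => by
    obtain ⟨y, hy⟩ := hran x
    exact ⟨y, hi hy⟩⟩
  have hsur : ¬ Function.Surjective A := fun hs => hinj <| by
    rw [injective_iff_map_eq_zero]
    intro x hx
    obtain ⟨y, rfl⟩ := hs x
    exact hker y hx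
  rw [injective_iff_map_eq_zero] at hinj
  push Not at hinj
  obtain ⟨x, hx, hx0⟩ := hinj
  have h1 : ascent A = 1 := ascent_eq_one hx hx0 hker
  exact ⟨hc, by rw [h1, descent_eq_one hsur hran], by rw [h1]; exact ENat.natCast_lt_top 1⟩

theorem isSimilarToInvertibleIsometry_of_zpow_bounded (u : (X →L[ℂ] X)ˣ) {M : ℝ}
    (hu : ∀ n : ℤ, ‖((u ^ n : (X →L[ℂ] X)ˣ) : X →L[ℂ] X)‖ ≤ M) :
    IsSimilarToInvertibleIsometry (u : X →L[ℂ] X) := by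
  set J := orbitMap u hu
  -- The coordinate `n = 0` bounds `J` below, so its range is closed and can serve as `Y`.
  have hlow : ∀ x, ‖x‖ ≤ ‖J x‖ := fun x => by
    simpa [J, orbitMap_apply] using BoundedContinuousFunction.norm_coe_le_norm (J x) 0
  have hanti : AntilipschitzWith 1 J := J.antilipschitz_of_bound (by simpa using hlow)
  have hclosed : IsClosed (Set.range J) := hanti.isClosed_range J.uniformContinuous
  let E := J.equivRange hanti.injective hclosed
  have hcomplete : CompleteSpace J.range := hclosed.completeSpace_coe
  have hE : ∀ x, ‖E x‖ = ‖J x‖ := fun _ => rfl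
  let L : X ≃L[ℂ] X := ContinuousLinearEquiv.unitsEquiv ℂ X u
  have hL : ∀ x, L x = (u : X →L[ℂ] X) x := fun _ => rfl
  have hiso : ∀ x, ‖J ((u : X →L[ℂ] X) x)‖ = ‖J x‖ := fun x => by
    apply le_antisymm
    · simpa using norm_orbitMap_apply_le u hu 1 x
    · have h := norm_orbitMap_apply_le u hu (-1) ((u : X →L[ℂ] X) x)
      rwa [zpow_neg_one, ← mul_apply_eq_comp, Units.inv_mul,
        one_apply_eq_self] at h
  refine ⟨J.range, inferInstance, inferInstance, hcomplete, E,
    ⟨((E.symm.trans L).trans E).toLinearEquiv, fun y => ?_⟩, fun x => ?_⟩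
  · obtain ⟨x, rfl⟩ := E.surjective y
    simp [hE, hL, hiso]
  · simp [hL]

end Operators

/-! ### The theorem -/

theorem theorem3p1 {X : Type u} [NormedAddCommGroup X] [NormedSpace ℂ X] [CompleteSpace X]
    (S T : X →L[ℂ] X) (m : ℕ) (hm : 1 ≤ m)
    (hTS : (elemTriangle T S ^ m) (ContinuousLinearMap.id ℂ X) = 0)
    (hS : IsPowerBounded S) (hT : IsPowerBounded T) :
    IsPolaroid S ∧
      (IsUnit S → IsSimilarToInvertibleIsometry S) ∧
      (¬ IsUnit S → spectrum ℂ S = Metric.closedBall (0 : ℂ) 1) := by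
  have h1 : T * S = 1 := mul_eq_one_of_elemTriangle_pow_eq_zero hS hT hTS
  obtain ⟨M₁, hM₁⟩ := hS
  obtain ⟨M₂, hM₂⟩ := hT
  have hSM : ∀ n : ℕ, ‖S ^ n‖ ≤ max M₁ M₂ := fun n => (hM₁ n).trans (le_max_left _ _)
  have hTM : ∀ n : ℕ, ‖T ^ n‖ ≤ max M₁ M₂ := fun n => (hM₂ n).trans (le_max_right _ _)
  have hb : ¬ IsUnit S → spectrum ℂ S = Metric.closedBall (0 : ℂ) 1 := fun hu => by
    apply Set.Subset.antisymm
    · intro z hz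
      rw [mem_closedBall_zero_iff]
      by_contra! h
      exact hz (resolvent_of_one_lt_norm hM₁ h).1
    · rw [← closure_ball (0 : ℂ) one_ne_zero]
      refine closure_minimal (fun z hz => ?_) (spectrum.isClosed S)
      intro hr
      exact hu (isUnit_of_mem_resolventSet h1 hM₂ (mem_ball_zero_iff.1 hz) hr)
  refine ⟨Set.Subset.antisymm (fun c hc => ?_) fun c hc => hc.1, fun hu => ?_, hb⟩
  · by_cases hu : IsUnit S
    · obtain ⟨u, rfl⟩ := hu
      have h2 : (u : X →L[ℂ] X) * T = 1 := by
        rw [left_inv_eq_right_inv h1 u.mul_inv, Units.mul_inv]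
      exact mem_poles_of_doubly_power_bounded h2 h1 hSM hTM hc
    · obtain ⟨hc1, hc2⟩ := hc
      rw [hb hu] at hc1 hc2
      refine absurd ?_ hc2
      -- The closure of an open set in `ℂ` is perfect, so the closed disc has no isolated points.
      have hperf := (Metric.isOpen_ball (x := (0 : ℂ)) (ε := 1)).preperfect.perfect_closure
      rw [closure_ball (0 : ℂ) one_ne_zero] at hperf
      exact hperf.acc c hc1
  · obtain ⟨u, rfl⟩ := hu
    have h2 : ((u⁻¹ : (X →L[ℂ] X)ˣ) : X →L[ℂ] X) = T :=
      (left_inv_eq_right_inv h1 u.mul_inv).symm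
    refine isSimilarToInvertibleIsometry_of_zpow_bounded u (M := max M₁ M₂) fun n => ?_
    rcases n.eq_nat_or_neg with ⟨k, rfl | rfl⟩
    · simpa using hSM k
    · rw [zpow_neg, zpow_natCast, ← inv_pow, Units.val_pow_eq_pow_val, h2]
      exact hTM k
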